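/- For a bounded open set $A\subset\mathbb R^2$ with Lipschitz boundary and a portion $\Gamma$ of $\partial A$ with nonempty relative interior in $\partial A$, let $$K(\Gamma,A):=\inf\Big\{\int_A|\nabla v|^2\,dx\,dy:\ v\in H^1(A),\ \int_\Gamma v^2\,d\mathcal H^1=1,\ v=0\text{ on }\partial A\setminus\Gamma\Big\},$$ where the boundary values of $v$ are understood in the sense of traces. Let $g:[0,a_0]\to\mathbb R$ be a Lipschitz function and let $\|g'\|_\infty$ be the essential supremum of $|g'|$ on $(0,a_0)$. For $0\le a_1<a_2\le a_0$ and $b>0$ set $$\Gamma(a_1,a_2):=\{(x,g(x)):x\in(a_1,a_2)\},\qquad R(a_1,a_2,b):=\{(x,y):x\in(a_1,a_2),\ y\in(g(x),g(x)+b)\}.$$ Then $$\lim_{a_2-a_1\to0}K\big(\Gamma(a_1,a_2),R(a_1,a_2,b)\big)=+\infty\quad\text{uniformly with respect to }b;$$ that is, for every $M\in\mathbb R$ there is $\delta>0$ such that $K(\Gamma(a_1,a_2),R(a_1,a_2,b))>M$ for all $b>0$ and all $0\le a_1<a_2\le a_0$ with $a_2-a_1<\delta$. Moreover, for all such $a_1,a_2$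 (without restriction on $a_2-a_1$) and all $b>0$, $$K\big(\Gamma(a_1,a_2),R(a_1,a_2,b)\big)\ \ge\ (1+\|g'\|_\infty^2)^{-3/2}\,\frac{\pi}{2(a_2-a_1)}.$$ -/

import Mathlib

open MeasureTheory Filter Topology
open scoped NNReal ENNReal ContDiff

/-- The Euclidean plane, with its Euclidean norm and Lebesgue measure. -/
abbrev Plane : Type := EuclideanSpace ℝ (Fin 2)

/-- `G` is the weak gradient of `v` on the open set `A`: integration by parts holds, in every
direction `e`, against every smooth test function compactly supported in `A`. -/
def IsWeakGradient (A : Set Plane) (v : Plane → ℝ) (G : Plane → Plane) : Prop :=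
  ∀ φ : Plane → ℝ, ContDiff ℝ ∞ φ → HasCompactSupport φ → tsupport φ ⊆ A →
    ∀ e : Plane,
      ∫ p in A, v p * fderiv ℝ φ p e = - ∫ p in A, inner ℝ (G p) e * φ p

/-- `v` belongs to the Sobolev space `H¹(A)` and `G` is its weak gradient. -/
structure IsH1 (A : Set Plane) (v : Plane → ℝ) (G : Plane → Plane) : Prop where
  memLp : MemLp v 2 (volume.restrict A)
  memLp_grad : MemLp G 2 (volume.restrict A)
  weakGradient : IsWeakGradient A v G

/-- One-dimensional Hausdorff measure on the boundary of `A`. -/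
noncomputable def boundaryMeasure (A : Set Plane) : Measure Plane :=
  (Measure.hausdorffMeasure 1).restrict (frontier A)

/-- `w` is the trace on `∂A` of the function `v ∈ H¹(A)` with weak gradient `G`: there are
functions `φ n`, smooth up to the boundary, that converge to `v` in `H¹(A)` and whose
restrictions to `∂A` converge to `w` in `L²(∂A)` (for a bounded Lipschitz domain `A` this is
the usual trace operator). -/
structure HasTrace (A : Set Plane) (v : Plane → ℝ) (G : Plane → Plane) (w : Plane → ℝ) :
    Prop where
  memLp : MemLp w 2 (boundaryMeasure A)
  approx : ∃ φ : ℕ → Plane → ℝ, (∀ n, ContDiff ℝ ∞ (φ n)) ∧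
    Tendsto (fun n => eLpNorm (fun p => φ n p - v p) 2 (volume.restrict A)) atTop (𝓝 0) ∧
    Tendsto (fun n => eLpNorm (fun p => gradient (φ n) p - G p) 2 (volume.restrict A))
      atTop (𝓝 0) ∧
    Tendsto (fun n => eLpNorm (fun p => φ n p - w p) 2 (boundaryMeasure A)) atTop (𝓝 0)

/-- The Dirichlet energies `∫_A |∇v|²` of the competitors: `v ∈ H¹(A)` whose trace `w`
satisfies `∫_Γ w² dH¹ = 1` and `w = 0` on `∂A \ Γ`. -/
def competitorEnergies (Γ A : Set Plane) : Set ℝ :=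
  {E | ∃ (v : Plane → ℝ) (G : Plane → Plane) (w : Plane → ℝ),
    IsH1 A v G ∧ HasTrace A v G w ∧
    ∫ p in Γ, w p ^ 2 ∂(Measure.hausdorffMeasure 1) = 1 ∧
    (∀ᵐ p ∂((Measure.hausdorffMeasure 1).restrict (frontier A \ Γ)), w p = 0) ∧
    E = ∫ p in A, ‖G p‖ ^ 2}

/-- The constant `K(Γ, A)`. (For the infimum in `ℝ`, an empty family would give the value `0`.) -/
noncomputable def capacityK (Γ A : Set Plane) : ℝ := sInf (competitorEnergies Γ A)

/-- `Γ(a₁, a₂)`: the graph of `g` over the open interval `(a₁, a₂)`. -/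
def graphArc (g : ℝ → ℝ) (a₁ a₂ : ℝ) : Set Plane :=
  {p | p 0 ∈ Set.Ioo a₁ a₂ ∧ p 1 = g (p 0)}

/-- `R(a₁, a₂, b)`: the region over `(a₁, a₂)` between the graphs of `g` and `g + b`. -/
def graphStrip (g : ℝ → ℝ) (a₁ a₂ b : ℝ) : Set Plane :=
  {p | p 0 ∈ Set.Ioo a₁ a₂ ∧ p 1 ∈ Set.Ioo (g (p 0)) (g (p 0) + b)}

/-- `‖g′‖_∞`: the essential supremum of `|g′|` on `(0, a₀)`. -/
noncomputable def derivSupNorm (g : ℝ → ℝ) (a₀ : ℝ) : ℝ :=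
  (eLpNorm (deriv g) ⊤ (volume.restrict (Set.Ioo 0 a₀))).toReal

/-! Shear the strip onto a rectangle, with `t` the height above the graph, and fix `0 < k < π / (a₂
- a₁)`. On each curve `t = const`, Wirtinger's inequality (`wirtinger_le`) bounds `k² ∫ φ²` by the
tangential energy plus values at the two lateral sides. On each vertical segment, `mul_sq_le` bounds
`k φ²` at the bottom by the vertical energy plus `k² ∫ φ²` plus `k φ²` at the top. Integrating both
and adding, the `k²` terms cancel: `k` times the integral of `φ²` over the base is at most `2 (1 +
s²)` times the energy, up to terms on `∂A \ Γ`. The height `b` enters no constant.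

Passing from `dx` to arc length costs `√(1 + s²)`. In the limit of the smooth functions defining the
trace, the terms on `∂A \ Γ` vanish and the integral over `Γ` becomes 1. Letting `k` tend to `π /
(a₂ - a₁)` gives the explicit bound, which implies the uniform divergence. -/

/-! ### One-dimensional inequalities -/

/-- A Riccati (ground state) inequality: a solution `α` of `α' + α² = c` bounds the Dirichlet
energy of an absolutely continuous function from below by boundary terms. -/
theorem AbsolutelyContinuousOnInterval.riccati_le {f α D : ℝ → ℝ} {a b c : ℝ} (hab : a ≤ b)
    (hf : AbsolutelyContinuousOnInterval f a b) (hα : AbsolutelyContinuousOnInterval α a b)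
    (hα' : ∀ x ∈ Set.Icc a b, HasDerivAt α (c - α x ^ 2) x)
    (hD : IntervalIntegrable D volume a b)
    (hfD : ∀ᵐ x, x ∈ Set.Icc a b → deriv f x ^ 2 ≤ D x) :
    α b * f b ^ 2 - α a * f a ^ 2 ≤ (∫ x in a..b, D x) + c * ∫ x in a..b, f x ^ 2 := by
  have hh : AbsolutelyContinuousOnInterval (fun x => α x * (f x * f x)) a b :=
    hα.fun_mul (hf.fun_mul hf)
  have hf2 : IntervalIntegrable (fun x => f x ^ 2) volume a b :=
    (hf.continuousOn.pow 2).intervalIntegrable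
  have hI := hh.integral_deriv_eq_sub
  have hle : ∫ x in a..b, deriv (fun x => α x * (f x * f x)) x ≤
      ∫ x in a..b, (D x + c * f x ^ 2) := by
    apply intervalIntegral.integral_mono_ae_restrict hab hh.intervalIntegrable_deriv
      (hD.add (hf2.const_mul c))
    rw [EventuallyLE, ae_restrict_iff' measurableSet_Icc]
    filter_upwards [hf.ae_differentiableAt, hfD] with x hx hxD hxI
    have hfx := (hx (by rwa [Set.uIcc_of_le hab])).hasDerivAt
    have hd : deriv (fun x => α x * (f x * f x)) x = _ :=
      ((hα' x hxI).mul (hfx.mul hfx)).deriv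
    rw [hd, Pi.mul_apply]
    -- Completing the square: `(α f²)' = c f² + f'² - (f' - α f)²`.
    nlinarith [hxD hxI, sq_nonneg (deriv f x - α x * f x)]
  rw [intervalIntegral.integral_add hD (hf2.const_mul c),
    intervalIntegral.integral_const_mul] at hle
  linarith [hI, hle, pow_two (f a), pow_two (f b), congrArg (α a * ·) (pow_two (f a)),
    congrArg (α b * ·) (pow_two (f b))]

/-- This Riccati solution, with `c = -k²`, is the logarithmic derivative of the ground state `cos (k
(x - m))`; the hypothesis avoids its zeros. -/
theorem hasDerivAt_neg_mul_tan {k m x : ℝ} (hx : |k * (x - m)| < Real.pi / 2) :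
    HasDerivAt (fun x => -k * Real.tan (k * (x - m)))
      (-k ^ 2 - (-k * Real.tan (k * (x - m))) ^ 2) x := by
  have hc : Real.cos (k * (x - m)) ≠ 0 :=
    (Real.cos_pos_of_mem_Ioo ⟨(abs_lt.1 hx).1, (abs_lt.1 hx).2⟩).ne'
  have h1 : HasDerivAt (fun x => k * (x - m)) k x := by
    simpa using ((hasDerivAt_id x).sub_const m).const_mul k
  have h2 := ((Real.hasDerivAt_tan hc).comp x h1).const_mul (-k)
  refine h2.congr_deriv ?_
  rw [Real.tan_eq_sin_div_cos]
  field_simp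
  nlinarith [Real.sin_sq_add_cos_sq (k * (x - m))]

/-- Wirtinger's inequality on an interval, with boundary terms. -/
theorem AbsolutelyContinuousOnInterval.wirtinger_le {f D : ℝ → ℝ} {a b k : ℝ} (hab : a ≤ b)
    (hk : 0 < k) (hkab : k * (b - a) < Real.pi) (hf : AbsolutelyContinuousOnInterval f a b)
    (hD : IntervalIntegrable D volume a b)
    (hfD : ∀ᵐ x, x ∈ Set.Icc a b → deriv f x ^ 2 ≤ D x) :
    k ^ 2 * ∫ x in a..b, f x ^ 2 ≤
      (∫ x in a..b, D x) + k * Real.tan (k * ((b - a) / 2)) * (f a ^ 2 + f b ^ 2) := by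
  have hI : ∀ x ∈ Set.Icc a b, |k * (x - (a + b) / 2)| < Real.pi / 2 := by
    intro x hx
    rw [abs_lt]
    constructor <;> nlinarith [hx.1, hx.2]
  -- Centring at the midpoint lets `tan` be regular on the whole interval exactly when `k (b - a) <
  -- π`, and oddness gives both endpoints the same weight.
  have hα : AbsolutelyContinuousOnInterval
      (fun x => -k * Real.tan (k * (x - (a + b) / 2))) a b := by
    apply ContDiffOn.absolutelyContinuousOnInterval
    rw [Set.uIcc_of_le hab]
    intro x hx
    have hc : Real.cos (k * (x - (a + b) / 2)) ≠ 0 :=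
      (Real.cos_pos_of_mem_Ioo ⟨(abs_lt.1 (hI x hx)).1, (abs_lt.1 (hI x hx)).2⟩).ne'
    apply ContDiffAt.contDiffWithinAt
    exact contDiffAt_const.mul (ContDiffAt.comp (g := Real.tan)
      (f := fun x => k * (x - (a + b) / 2)) x (Real.contDiffAt_tan.2 hc) (by fun_prop))
  have h := hf.riccati_le hab hα (c := -k ^ 2)
    (fun x hx => hasDerivAt_neg_mul_tan (hI x hx)) hD hfD
  have e1 : k * (b - (a + b) / 2) = k * ((b - a) / 2) := by ring
  have e2 : k * (a - (a + b) / 2) = -(k * ((b - a) / 2)) := by ring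
  simp only [e1, e2, Real.tan_neg] at h
  linarith

/-- The constant `-k` solves the Riccati equation with `c = k²` on intervals of any length; hence
the uniformity in the height of the strip. -/
theorem AbsolutelyContinuousOnInterval.mul_sq_le {f D : ℝ → ℝ} {a b k : ℝ} (hab : a ≤ b)
    (hf : AbsolutelyContinuousOnInterval f a b) (hD : IntervalIntegrable D volume a b)
    (hfD : ∀ᵐ x, x ∈ Set.Icc a b → deriv f x ^ 2 ≤ D x) :
    k * f a ^ 2 ≤ (∫ x in a..b, D x) + k ^ 2 * (∫ x in a..b, f x ^ 2) + k * f b ^ 2 := by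
  have h := hf.riccati_le hab (α := fun _ => -k) (c := k ^ 2)
    (contDiffOn_const.absolutelyContinuousOnInterval)
    (fun x _ => by simpa using hasDerivAt_const x (-k)) hD hfD
  linarith

/-! ### The shear and its calculus -/

/-- The shear `(x, t) ↦ (x, g x + t)`, which maps rectangles onto strips above the graph of `g`. -/
noncomputable def shear (g : ℝ → ℝ) (x t : ℝ) : Plane := !₂[x, g x + t]

@[simp] theorem shear_zero (g : ℝ → ℝ) (x t : ℝ) : shear g x t 0 = x := rfl

@[simp] theorem shear_one (g : ℝ → ℝ) (x t : ℝ) : shear g x t 1 = g x + t := rfl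

theorem shear_eq_iff {g : ℝ → ℝ} {x t : ℝ} {p : Plane} :
    shear g x t = p ↔ x = p 0 ∧ t = p 1 - g (p 0) := by
  constructor
  · rintro rfl
    simp
  · rintro ⟨rfl, rfl⟩
    ext i
    fin_cases i <;> simp [shear]

theorem shear_apply_zero_one (g : ℝ → ℝ) (p : Plane) : shear g (p 0) (p 1 - g (p 0)) = p :=
  shear_eq_iff.2 ⟨rfl, rfl⟩

theorem continuous_shear {g : ℝ → ℝ} (hg : Continuous g) :
    Continuous fun z : ℝ × ℝ => shear g z.1 z.2 := by
  apply (PiLp.continuous_toLp 2 _).comp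
  apply continuous_pi
  intro i
  fin_cases i
  · exact continuous_fst
  · exact (hg.comp continuous_fst).add continuous_snd

theorem norm_sq_vec_two (a b : ℝ) : ‖(!₂[a, b] : Plane)‖ ^ 2 = a ^ 2 + b ^ 2 := by
  simp [EuclideanSpace.real_norm_sq_eq]

theorem dist_shear_sq (g : ℝ → ℝ) (x y t u : ℝ) :
    dist (shear g x t) (shear g y u) ^ 2 = (x - y) ^ 2 + (g x + t - (g y + u)) ^ 2 := by
  rw [dist_eq_norm, ← norm_sq_vec_two]
  congr 2
  ext i
  fin_cases i <;> simp [shear]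

theorem lipschitzWith_shear_left {g : ℝ → ℝ} {s : ℝ≥0} (hg : LipschitzWith s g) (t : ℝ) :
    LipschitzWith (NNReal.sqrt (1 + s ^ 2)) fun x => shear g x t := by
  refine LipschitzWith.of_dist_le_mul fun x y => ?_
  apply le_of_sq_le_sq _ (by positivity)
  rw [dist_shear_sq, mul_pow, Real.coe_sqrt, Real.sq_sqrt (by positivity)]
  have h := hg.dist_le_mul x y
  rw [Real.dist_eq, Real.dist_eq] at h
  have h2 := pow_le_pow_left₀ (abs_nonneg _) h 2
  rw [mul_pow, sq_abs, sq_abs] at h2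
  rw [Real.dist_eq, sq_abs]
  push_cast
  nlinarith

theorem isometry_shear_right (g : ℝ → ℝ) (x : ℝ) : Isometry fun t => shear g x t := by
  refine Isometry.of_dist_eq fun t u => ?_
  rw [← sq_eq_sq₀ dist_nonneg dist_nonneg, dist_shear_sq, Real.dist_eq, sq_abs]
  ring

theorem HasDerivAt.vec_two {u v : ℝ → ℝ} {u' v' x : ℝ} (hu : HasDerivAt u u' x)
    (hv : HasDerivAt v v' x) : HasDerivAt (fun x => (!₂[u x, v x] : Plane)) !₂[u', v'] x := by
  have h : HasDerivAt (fun x => ![u x, v x]) ![u', v'] x := by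
    rw [hasDerivAt_pi]
    intro i
    fin_cases i
    exacts [hu, hv]
  exact (PiLp.continuousLinearEquiv 2 ℝ fun _ : Fin 2 => ℝ).symm.hasFDerivAt.comp_hasDerivAt x h

theorem hasDerivAt_shear_left {g : ℝ → ℝ} {x : ℝ} (hg : DifferentiableAt ℝ g x) (t : ℝ) :
    HasDerivAt (fun x => shear g x t) !₂[1, deriv g x] x :=
  (hasDerivAt_id x).vec_two (hg.hasDerivAt.add_const t)

theorem hasDerivAt_shear_right (g : ℝ → ℝ) (x t : ℝ) :
    HasDerivAt (fun t => shear g x t) !₂[0, 1] t :=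
  (hasDerivAt_const t x).vec_two ((hasDerivAt_id t).const_add (g x))

theorem fderiv_apply_sq_le (φ : Plane → ℝ) (p e : Plane) :
    (fderiv ℝ φ p e) ^ 2 ≤ ‖gradient φ p‖ ^ 2 * ‖e‖ ^ 2 := by
  rw [← inner_gradient_left, ← mul_pow, ← sq_abs]
  exact pow_le_pow_left₀ (abs_nonneg _) (abs_real_inner_le_norm _ _) 2

theorem continuous_gradient {φ : Plane → ℝ} (hφ : ContDiff ℝ 1 φ) : Continuous (gradient φ) :=
  (InnerProductSpace.toDual ℝ Plane).symm.continuous.comp (hφ.continuous_fderiv one_ne_zero)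

theorem ContDiff.absolutelyContinuousOnInterval_comp {φ : Plane → ℝ} (hφ : ContDiff ℝ 1 φ)
    {γ : ℝ → Plane} {K : ℝ≥0} (hγ : LipschitzWith K γ) (a b : ℝ) :
    AbsolutelyContinuousOnInterval (fun x => φ (γ x)) a b := by
  obtain ⟨L, hL⟩ := LocallyLipschitzOn.exists_lipschitzOnWith_of_compact
    ((isCompact_uIcc (a := a) (b := b)).image hγ.continuous)
    (hφ.locallyLipschitz.locallyLipschitzOn)
  exact (hL.comp hγ.lipschitzOnWith (Set.mapsTo_image _ _)).absolutelyContinuousOnInterval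

/-! ### The estimate for smooth functions in sheared coordinates -/

/-- The energy of a smooth function in the strip above the graph of a Lipschitz function bounds
its square integral over the graph, up to square integrals over the rest of the boundary. -/
theorem mul_integral_graph_sq_le {φ : Plane → ℝ} (hφ : ContDiff ℝ 1 φ) {g : ℝ → ℝ} {s : ℝ≥0}
    (hg : LipschitzWith s g) {a₁ a₂ b k : ℝ} (ha : a₁ ≤ a₂) (hb : 0 ≤ b) (hk : 0 < k)
    (hka : k * (a₂ - a₁) < Real.pi) :
    k * ∫ x in a₁..a₂, φ (shear g x 0) ^ 2 ≤
      2 * (1 + (s : ℝ) ^ 2) * (∫ x in a₁..a₂, ∫ t in (0 : ℝ)..b, ‖gradient φ (shear g x t)‖ ^ 2) +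
      k * (∫ x in a₁..a₂, φ (shear g x b) ^ 2) +
      k * Real.tan (k * ((a₂ - a₁) / 2)) *
        ∫ t in (0 : ℝ)..b, (φ (shear g a₁ t) ^ 2 + φ (shear g a₂ t) ^ 2) := by
  set S : ℝ := 1 + (s : ℝ) ^ 2 with hS
  set C : ℝ := k * Real.tan (k * ((a₂ - a₁) / 2))
  have hS1 : 1 ≤ S := by simp [hS]
  set q : ℝ × ℝ → ℝ := fun z => ‖gradient φ (shear g z.1 z.2)‖ ^ 2 with hq
  set f : ℝ × ℝ → ℝ := fun z => φ (shear g z.1 z.2) ^ 2 with hf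
  have hsh := continuous_shear hg.continuous
  have hqc : Continuous q := (((continuous_gradient hφ).comp hsh).norm.pow 2)
  have hfc : Continuous f := (hφ.continuous.comp hsh).pow 2
  have hqx : Continuous fun x => ∫ t in (0 : ℝ)..b, q (x, t) :=
    intervalIntegral.continuous_parametric_intervalIntegral_of_continuous' (by fun_prop) _ _
  have hfx : Continuous fun x => ∫ t in (0 : ℝ)..b, f (x, t) :=
    intervalIntegral.continuous_parametric_intervalIntegral_of_continuous' (by fun_prop) _ _
  have hqt : Continuous fun t => ∫ x in a₁..a₂, q (x, t) :=
    intervalIntegral.continuous_parametric_intervalIntegral_of_continuous'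
      (f := fun t x => q (x, t)) (by fun_prop) _ _
  have hft : Continuous fun t => ∫ x in a₁..a₂, f (x, t) :=
    intervalIntegral.continuous_parametric_intervalIntegral_of_continuous'
      (f := fun t x => f (x, t)) (by fun_prop) _ _
  have swap : ∀ h : ℝ × ℝ → ℝ, Continuous h →
      ∫ t in (0 : ℝ)..b, ∫ x in a₁..a₂, h (x, t) = ∫ x in a₁..a₂, ∫ t in (0 : ℝ)..b, h (x, t) := by
    intro h hh
    refine (intervalIntegral_intervalIntegral_swap (F := fun x t => h (x, t)) ?_).symm
    exact (hh.continuousOn.integrableOn_compact (isCompact_uIcc.prod isCompact_uIcc)).mono_set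
      (Set.prod_mono Set.uIoc_subset_uIcc Set.uIoc_subset_uIcc)
  -- The tangent `(1, g')` exists almost everywhere and has squared norm at most `S`.
  have hX : ∀ t, k ^ 2 * ∫ x in a₁..a₂, f (x, t) ≤
      S * (∫ x in a₁..a₂, q (x, t)) + C * (f (a₁, t) + f (a₂, t)) := by
    intro t
    rw [← intervalIntegral.integral_const_mul S]
    apply AbsolutelyContinuousOnInterval.wirtinger_le ha hk hka
      (hφ.absolutelyContinuousOnInterval_comp (lipschitzWith_shear_left hg t) a₁ a₂)
      (D := fun x => S * q (x, t)) (Continuous.intervalIntegrable (by fun_prop) _ _)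
    filter_upwards [hg.ae_differentiableAt_real] with x hx _
    have h1 := (((hφ.differentiable one_ne_zero) (shear g x t)).hasFDerivAt).comp_hasDerivAt x
      (hasDerivAt_shear_left hx t)
    have hd : deriv (fun x => φ (shear g x t)) x = _ := h1.deriv
    rw [hd]
    refine (fderiv_apply_sq_le _ _ _).trans ?_
    rw [norm_sq_vec_two, mul_comm]
    have h2 : deriv g x ^ 2 ≤ (s : ℝ) ^ 2 := by
      rw [← sq_abs]
      exact pow_le_pow_left₀ (abs_nonneg _) (norm_deriv_le_of_lipschitz hg) 2
    apply mul_le_mul_of_nonneg_right _ (sq_nonneg _)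
    rw [hS]
    linarith
  have hT : ∀ x, k * f (x, 0) ≤
      (∫ t in (0 : ℝ)..b, q (x, t)) + k ^ 2 * (∫ t in (0 : ℝ)..b, f (x, t)) + k * f (x, b) := by
    intro x
    apply AbsolutelyContinuousOnInterval.mul_sq_le hb
      (hφ.absolutelyContinuousOnInterval_comp (isometry_shear_right g x).lipschitz 0 b)
      (D := fun t => q (x, t)) (Continuous.intervalIntegrable (by fun_prop) _ _)
    refine ae_of_all _ fun t _ => ?_
    have h1 := (((hφ.differentiable one_ne_zero) (shear g x t)).hasFDerivAt).comp_hasDerivAt t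
      (hasDerivAt_shear_right g x t)
    have hd : deriv (fun t => φ (shear g x t)) t = _ := h1.deriv
    rw [hd]
    refine (fderiv_apply_sq_le _ _ _).trans ?_
    rw [norm_sq_vec_two]
    simp [hq]
  have hX' := intervalIntegral.integral_mono (μ := volume) hb
    (Continuous.intervalIntegrable (by fun_prop) _ _)
    (Continuous.intervalIntegrable (by fun_prop) _ _) hX
  have hT' := intervalIntegral.integral_mono (μ := volume) ha
    (Continuous.intervalIntegrable (by fun_prop) _ _)
    (Continuous.intervalIntegrable (by fun_prop) _ _) hT
  rw [intervalIntegral.integral_add (Continuous.intervalIntegrable (by fun_prop) _ _)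
    (Continuous.intervalIntegrable (by fun_prop) _ _)] at hX' hT'
  rw [intervalIntegral.integral_add (Continuous.intervalIntegrable (by fun_prop) _ _)
    (Continuous.intervalIntegrable (by fun_prop) _ _)] at hT'
  simp only [intervalIntegral.integral_const_mul] at hX' hT'
  rw [swap q hqc, swap f hfc] at hX'
  have hQ : 0 ≤ ∫ x in a₁..a₂, ∫ t in (0 : ℝ)..b, q (x, t) :=
    intervalIntegral.integral_nonneg ha fun x _ =>
      intervalIntegral.integral_nonneg hb fun t _ => sq_nonneg _
  -- The double integrals of `k² f` cancel, and `1 ≤ S` merges the energy factors `S` and `1` into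
  -- `2 S`.
  nlinarith [mul_le_mul_of_nonneg_right hS1 hQ]

/-! ### Area, boundary and Hausdorff measure of the strip -/

noncomputable def shearHomeomorph {g : ℝ → ℝ} (hg : Continuous g) : ℝ × ℝ ≃ₜ Plane where
  toFun z := shear g z.1 z.2
  invFun p := (p 0, p 1 - g (p 0))
  left_inv z := by simp
  right_inv p := shear_apply_zero_one g p
  continuous_toFun := continuous_shear hg
  continuous_invFun := by fun_prop

/-- Each vertical line is merely translated, so Fubini suffices and `g` need not be differentiable.
-/
theorem measurePreserving_shear {g : ℝ → ℝ} (hg : Continuous g) :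
    MeasurePreserving fun z : ℝ × ℝ => shear g z.1 z.2 := by
  have h1 : MeasurePreserving (fun z : ℝ × ℝ => (z.1, g z.1 + z.2)) :=
    (MeasurePreserving.id volume).skew_product (g := fun x t => g x + t)
      (by fun_prop) (ae_of_all _ fun x => map_add_left_eq_self _ _)
  have h2 := (PiLp.volume_preserving_toLp (Fin 2)).comp
    (((volume_preserving_finTwoArrow ℝ).symm _).comp h1)
  convert h2 using 1
  funext z
  ext i
  fin_cases i <;> rfl

theorem shear_mem_graphStrip {g : ℝ → ℝ} {a₁ a₂ b x t : ℝ} :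
    shear g x t ∈ graphStrip g a₁ a₂ b ↔ x ∈ Set.Ioo a₁ a₂ ∧ t ∈ Set.Ioo 0 b := by
  simp [graphStrip]

theorem graphStrip_eq (g : ℝ → ℝ) (a₁ a₂ b : ℝ) :
    graphStrip g a₁ a₂ b = {p | p 0 ∈ Set.Ioo a₁ a₂ ∧ p 1 - g (p 0) ∈ Set.Ioo 0 b} := by
  ext p
  simp [graphStrip, sub_lt_iff_lt_add']

theorem isOpen_graphStrip {g : ℝ → ℝ} (hg : Continuous g) (a₁ a₂ b : ℝ) :
    IsOpen (graphStrip g a₁ a₂ b) := by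
  rw [graphStrip_eq]
  exact (isOpen_Ioo.preimage (by fun_prop : Continuous fun p : Plane => p 0)).inter
    (isOpen_Ioo.preimage (by fun_prop : Continuous fun p : Plane => p 1 - g (p 0)))

theorem setIntegral_graphStrip {g : ℝ → ℝ} (hg : Continuous g) {a₁ a₂ b : ℝ} (ha : a₁ ≤ a₂)
    (hb : 0 ≤ b) {h : Plane → ℝ} (hh : Continuous h) :
    ∫ p in graphStrip g a₁ a₂ b, h p =
      ∫ x in a₁..a₂, ∫ t in (0 : ℝ)..b, h (shear g x t) := by
  rw [← (measurePreserving_shear hg).setIntegral_preimage_emb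
    (shearHomeomorph hg).measurableEmbedding]
  have e : (fun z : ℝ × ℝ => shear g z.1 z.2) ⁻¹' graphStrip g a₁ a₂ b =
      Set.Ioo a₁ a₂ ×ˢ Set.Ioo 0 b := by
    ext z
    exact shear_mem_graphStrip
  have hc : Continuous fun z : ℝ × ℝ => h (shear g z.1 z.2) := hh.comp (continuous_shear hg)
  rw [e, Measure.volume_eq_prod, setIntegral_prod]
  · rw [intervalIntegral.integral_of_le ha, integral_Ioc_eq_integral_Ioo]
    simp_rw [intervalIntegral.integral_of_le hb, integral_Ioc_eq_integral_Ioo]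
  · exact (hc.continuousOn.integrableOn_compact (isCompact_Icc.prod isCompact_Icc)).mono_set
      (Set.prod_mono Set.Ioo_subset_Icc_self Set.Ioo_subset_Icc_self)

/-- A curve with a `1`-Lipschitz left inverse pushes length to at most Hausdorff measure. -/
theorem map_restrict_le_hausdorffMeasure {F : ℝ → Plane} (hF : Continuous F) {P : Plane → ℝ}
    (hP : LipschitzWith 1 P) (hPF : ∀ x, P (F x) = x) (I : Set ℝ) {E : Set Plane}
    (hE : Set.MapsTo F I E) :
    (volume.restrict I).map F ≤ (Measure.hausdorffMeasure 1).restrict E := by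
  refine Measure.le_iff.2 fun S hS => ?_
  rw [Measure.map_apply hF.measurable hS, Measure.restrict_apply (hF.measurable hS),
    Measure.restrict_apply hS, ← hausdorffMeasure_real]
  have h := hP.hausdorffMeasure_image_le (d := 1) zero_le_one (S ∩ E)
  simp only [ENNReal.coe_one, ENNReal.one_rpow, one_mul] at h
  refine le_trans (measure_mono ?_) h
  exact fun x hx => ⟨F x, ⟨hx.1, hE hx.2⟩, hPF x⟩

/-- A `K`-Lipschitz parametrization stretches length by at most `K`. This upper bound serves the arc
`Γ`; the top and the sides need only the lower bound from projections. -/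
theorem hausdorffMeasure_restrict_le_map {F : ℝ → Plane} {K : ℝ≥0} (hF : LipschitzWith K F)
    (I : Set ℝ) :
    (Measure.hausdorffMeasure 1).restrict (F '' I) ≤ K • (volume.restrict I).map F := by
  refine Measure.le_iff.2 fun S hS => ?_
  have hm := hF.continuous.measurable
  rw [Measure.smul_apply, Measure.map_apply hm hS, Measure.restrict_apply (hm hS),
    Measure.restrict_apply hS, ← hausdorffMeasure_real, Set.inter_comm, ← Set.image_inter_preimage,
    Set.inter_comm]
  simpa using hF.hausdorffMeasure_image_le (d := 1) zero_le_one (F ⁻¹' S ∩ I)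

theorem lipschitzWith_proj (i : Fin 2) : LipschitzWith 1 fun p : Plane => p i :=
  LipschitzWith.of_dist_le_mul fun p q => by
    simpa [Real.dist_eq, dist_eq_norm] using PiLp.norm_apply_le (p - q) i

theorem graphArc_eq_image (g : ℝ → ℝ) (a₁ a₂ : ℝ) :
    graphArc g a₁ a₂ = (fun x => shear g x 0) '' Set.Ioo a₁ a₂ := by
  ext p
  constructor
  · rintro ⟨h0, h1⟩
    exact ⟨p 0, h0, shear_eq_iff.2 ⟨rfl, by simp [h1]⟩⟩
  · rintro ⟨x, hx, rfl⟩
    exact ⟨hx, by simp⟩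

theorem shear_mem_closure_graphStrip {g : ℝ → ℝ} (hg : Continuous g) {a₁ a₂ b x t : ℝ}
    (ha : a₁ < a₂) (hb : 0 < b) (hx : x ∈ Set.Icc a₁ a₂) (ht : t ∈ Set.Icc 0 b) :
    shear g x t ∈ closure (graphStrip g a₁ a₂ b) := by
  have hz : (x, t) ∈ closure (Set.Ioo a₁ a₂ ×ˢ Set.Ioo 0 b) := by
    rw [closure_prod_eq, closure_Ioo ha.ne, closure_Ioo hb.ne]
    exact ⟨hx, ht⟩
  exact map_mem_closure (f := fun z : ℝ × ℝ => shear g z.1 z.2) (continuous_shear hg) hz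
    fun z hz => shear_mem_graphStrip.2 hz

theorem shear_mem_frontier_graphStrip {g : ℝ → ℝ} (hg : Continuous g) {a₁ a₂ b x t : ℝ}
    (ha : a₁ < a₂) (hb : 0 < b) (hx : x ∈ Set.Icc a₁ a₂) (ht : t ∈ Set.Icc 0 b)
    (hxt : ¬(x ∈ Set.Ioo a₁ a₂ ∧ t ∈ Set.Ioo 0 b)) :
    shear g x t ∈ frontier (graphStrip g a₁ a₂ b) := by
  rw [(isOpen_graphStrip hg a₁ a₂ b).frontier_eq]
  exact ⟨shear_mem_closure_graphStrip hg ha hb hx ht, fun h => hxt (shear_mem_graphStrip.1 h)⟩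

theorem closure_graphStrip_subset {g : ℝ → ℝ} (hg : Continuous g) (a₁ a₂ b : ℝ) :
    closure (graphStrip g a₁ a₂ b) ⊆
      {p | p 0 ∈ Set.Icc a₁ a₂ ∧ p 1 - g (p 0) ∈ Set.Icc 0 b} := by
  rw [graphStrip_eq]
  apply closure_minimal
  · rintro p ⟨h0, h1⟩
    exact ⟨Set.Ioo_subset_Icc_self h0, Set.Ioo_subset_Icc_self h1⟩
  · exact (isClosed_Icc.preimage (by fun_prop : Continuous fun p : Plane => p 0)).inter
      (isClosed_Icc.preimage (by fun_prop : Continuous fun p : Plane => p 1 - g (p 0)))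

theorem graphArc_subset_frontier {g : ℝ → ℝ} (hg : Continuous g) {a₁ a₂ b : ℝ} (ha : a₁ < a₂)
    (hb : 0 < b) : graphArc g a₁ a₂ ⊆ frontier (graphStrip g a₁ a₂ b) := by
  rw [graphArc_eq_image]
  rintro _ ⟨x, hx, rfl⟩
  exact shear_mem_frontier_graphStrip hg ha hb (Set.Ioo_subset_Icc_self hx) ⟨le_rfl, hb.le⟩
    (by simp)

theorem shear_mem_graphArc {g : ℝ → ℝ} {a₁ a₂ x t : ℝ} :
    shear g x t ∈ graphArc g a₁ a₂ ↔ x ∈ Set.Ioo a₁ a₂ ∧ t = 0 := by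
  simp [graphArc]

/-- Square integrals along a curve with a `1`-Lipschitz left inverse are bounded by square
integrals with respect to Hausdorff measure. -/
theorem setIntegral_sq_comp_le {F : ℝ → Plane} (hF : Continuous F) {P : Plane → ℝ}
    (hP : LipschitzWith 1 P) (hPF : ∀ x, P (F x) = x) {I : Set ℝ} {E : Set Plane}
    (hE : Set.MapsTo F I E) {u : Plane → ℝ} (hu : Continuous u)
    (hu2 : MemLp u 2 ((Measure.hausdorffMeasure 1).restrict E)) :
    ∫ x in I, u (F x) ^ 2 ≤ ∫ p in E, u p ^ 2 ∂(Measure.hausdorffMeasure 1) := by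
  rw [← integral_map (f := fun p => u p ^ 2) hF.aemeasurable
    (hu.pow 2).aestronglyMeasurable]
  exact integral_mono_measure (map_restrict_le_hausdorffMeasure hF hP hPF I hE)
    (ae_of_all _ fun p => sq_nonneg _) hu2.integrable_sq

theorem setIntegral_sq_le_mul {F : ℝ → Plane} {K : ℝ≥0} (hF : LipschitzWith K F) {a b : ℝ}
    {u : Plane → ℝ} (hu : Continuous u) :
    ∫ p in F '' Set.Ioo a b, u p ^ 2 ∂(Measure.hausdorffMeasure 1) ≤
      K * ∫ x in Set.Ioo a b, u (F x) ^ 2 := by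
  rw [← integral_map (f := fun p => u p ^ 2) hF.continuous.aemeasurable
    (hu.pow 2).aestronglyMeasurable, ← smul_eq_mul, ← NNReal.smul_def,
    ← integral_smul_nnreal_measure]
  refine integral_mono_measure (hausdorffMeasure_restrict_le_map hF _)
    (ae_of_all _ fun p => sq_nonneg _) (Integrable.smul_measure_nnreal ?_)
  rw [integrable_map_measure (g := fun p => u p ^ 2) (hu.pow 2).aestronglyMeasurable
    hF.continuous.aemeasurable]
  exact ((((hu.comp hF.continuous).pow 2).continuousOn.integrableOn_compact
    (isCompact_Icc (a := a) (b := b)))).mono_set Set.Ioo_subset_Icc_self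

/-! ### Passage to the limit and the lower bound for competitors -/

/-- This is continuity of the `L²` norm. Early terms of the sequence may fail to be square
integrable, so membership holds only eventually and the sequence is shifted before working in `Lp`.
-/
theorem tendsto_integral_norm_sq {α E : Type*} [MeasurableSpace α] [NormedAddCommGroup E]
    {μ : Measure α} {u : ℕ → α → E} {w : α → E} (hu : ∀ n, AEStronglyMeasurable (u n) μ)
    (hw : MemLp w 2 μ) (h : Tendsto (fun n => eLpNorm (fun p => u n p - w p) 2 μ) atTop (𝓝 0)) :
    (∀ᶠ n in atTop, MemLp (u n) 2 μ) ∧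
      Tendsto (fun n => ∫ p, ‖u n p‖ ^ 2 ∂μ) atTop (𝓝 (∫ p, ‖w p‖ ^ 2 ∂μ)) := by
  have hmem : ∀ᶠ n in atTop, MemLp (u n) 2 μ := by
    filter_upwards [h.eventually_lt_const ENNReal.zero_lt_top] with n hn
    have h1 : MemLp (fun p => u n p - w p) 2 μ := ⟨(hu n).sub hw.1, hn⟩
    simpa only [Pi.add_def, sub_add_cancel] using h1.add hw
  refine ⟨hmem, ?_⟩
  obtain ⟨N, hN⟩ := eventually_atTop.1 hmem
  have key : ∀ {f : α → E} (hf : MemLp f 2 μ), ∫ p, ‖f p‖ ^ 2 ∂μ = ‖hf.toLp f‖ ^ 2 := by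
    intro f hf
    rw [Lp.norm_toLp, hf.eLpNorm_eq_integral_rpow_norm (by norm_num) (by norm_num),
      ENNReal.toReal_ofReal (by positivity), ← Real.rpow_natCast, ← Real.rpow_mul (by positivity)]
    norm_num
  rw [← tendsto_add_atTop_iff_nat N]
  have hN' : ∀ n, MemLp (u (n + N)) 2 μ := fun n => hN _ (Nat.le_add_left _ _)
  simp_rw [fun n => key (hN' n), key hw]
  refine Tendsto.pow (Tendsto.norm ?_) 2
  refine (Lp.tendsto_Lp_iff_tendsto_eLpNorm'' _ hN' _ hw).2 ?_
  exact (tendsto_add_atTop_iff_nat N).2 h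

theorem mul_integral_graphArc_sq_le {φ : Plane → ℝ} (hφ : ContDiff ℝ 1 φ) {g : ℝ → ℝ} {s : ℝ≥0}
    (hg : LipschitzWith s g) {a₁ a₂ b k : ℝ} (ha : a₁ < a₂) (hb : 0 < b) (hk : 0 < k)
    (hka : k * (a₂ - a₁) < Real.pi)
    (hφ2 : MemLp φ 2 ((Measure.hausdorffMeasure 1).restrict
      (frontier (graphStrip g a₁ a₂ b) \ graphArc g a₁ a₂))) :
    k * ∫ p in graphArc g a₁ a₂, φ p ^ 2 ∂(Measure.hausdorffMeasure 1) ≤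
      √(1 + (s : ℝ) ^ 2) * (2 * (1 + (s : ℝ) ^ 2) *
        (∫ p in graphStrip g a₁ a₂ b, ‖gradient φ p‖ ^ 2) +
      (k + 2 * (k * Real.tan (k * ((a₂ - a₁) / 2)))) *
        ∫ p in frontier (graphStrip g a₁ a₂ b) \ graphArc g a₁ a₂, φ p ^ 2
          ∂(Measure.hausdorffMeasure 1)) := by
  have hgc := hg.continuous
  have hC : 0 ≤ k * Real.tan (k * ((a₂ - a₁) / 2)) := by
    refine mul_nonneg hk.le (Real.tan_nonneg_of_nonneg_of_le_pi_div_two ?_ ?_)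
    · exact mul_nonneg hk.le (by linarith)
    · linarith
  have hmem : ∀ {x t : ℝ}, x ∈ Set.Icc a₁ a₂ → t ∈ Set.Icc 0 b →
      ¬(x ∈ Set.Ioo a₁ a₂ ∧ t ∈ Set.Ioo 0 b) → ¬(x ∈ Set.Ioo a₁ a₂ ∧ t = 0) →
      shear g x t ∈ frontier (graphStrip g a₁ a₂ b) \ graphArc g a₁ a₂ :=
    fun hx ht h1 h2 => ⟨shear_mem_frontier_graphStrip hgc ha hb hx ht h1,
      fun h => h2 (shear_mem_graphArc.1 h)⟩
  have main := mul_integral_graph_sq_le hφ hg ha.le hb.le hk hka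
  have hG := setIntegral_sq_le_mul (lipschitzWith_shear_left hg 0) (a := a₁) (b := a₂)
    hφ.continuous
  rw [← graphArc_eq_image, Real.coe_sqrt] at hG
  push_cast at hG
  have hTop := setIntegral_sq_comp_le (lipschitzWith_shear_left hg b).continuous
    (lipschitzWith_proj 0) (fun x => shear_zero g x b) (I := Set.Ioo a₁ a₂)
    (fun x hx => hmem (Set.Ioo_subset_Icc_self hx) ⟨hb.le, le_rfl⟩ (by simp) (by simp [hb.ne']))
    hφ.continuous hφ2
  -- The lateral sides are parametrized by the ordinate, so that the second coordinate is a left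
  -- inverse.
  have hside : ∀ x, x ∈ Set.Icc a₁ a₂ → x ∉ Set.Ioo a₁ a₂ → _ := fun x hx hx' =>
    setIntegral_sq_comp_le (F := fun t => shear g x (t - g x))
      ((isometry_shear_right g x).continuous.comp (by fun_prop))
      (lipschitzWith_proj 1) (fun t => by simp) (I := Set.Ioo (g x) (g x + b))
      (fun t ht => hmem hx ⟨by linarith [ht.1], by linarith [ht.2]⟩
        (fun h => hx' h.1) (fun h => hx' h.1))
      hφ.continuous hφ2
  have hside' : ∀ x, x ∈ Set.Icc a₁ a₂ → x ∉ Set.Ioo a₁ a₂ →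
      ∫ t in (0 : ℝ)..b, φ (shear g x t) ^ 2 ≤
        ∫ p in frontier (graphStrip g a₁ a₂ b) \ graphArc g a₁ a₂, φ p ^ 2
          ∂(Measure.hausdorffMeasure 1) := by
    intro x hx hx'
    refine le_trans (le_of_eq ?_) (hside x hx hx')
    rw [← integral_Ioc_eq_integral_Ioo, ← intervalIntegral.integral_of_le (by linarith),
      intervalIntegral.integral_comp_sub_right (fun t => φ (shear g x t) ^ 2)]
    simp
  have h1 := hside' a₁ ⟨le_rfl, ha.le⟩ (by simp)
  have h2 := hside' a₂ ⟨ha.le, le_rfl⟩ (by simp)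
  have hcont : ∀ x, Continuous fun t => φ (shear g x t) ^ 2 := fun x =>
    (hφ.continuous.comp (isometry_shear_right g x).continuous).pow 2
  rw [← setIntegral_graphStrip hgc ha.le hb.le (h := fun p => ‖gradient φ p‖ ^ 2)
    ((continuous_gradient hφ).norm.pow 2),
    intervalIntegral.integral_add ((hcont _).intervalIntegrable _ _)
    ((hcont _).intervalIntegrable _ _), intervalIntegral.integral_of_le ha.le,
    intervalIntegral.integral_of_le ha.le, integral_Ioc_eq_integral_Ioo,
    integral_Ioc_eq_integral_Ioo] at main
  refine (mul_le_mul_of_nonneg_left hG hk.le).trans ?_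
  rw [mul_left_comm]
  refine mul_le_mul_of_nonneg_left (main.trans ?_) (Real.sqrt_nonneg _)
  -- The top and each of the two sides are bounded separately by the full integral over `∂A \ Γ`,
  -- whence the factor `k + 2 k tan`.
  nlinarith [mul_le_mul_of_nonneg_left hTop hk.le, mul_le_mul_of_nonneg_left (add_le_add h1 h2) hC]

theorem le_competitorEnergies {g : ℝ → ℝ} {s : ℝ≥0} (hg : LipschitzWith s g) {a₁ a₂ b E : ℝ}
    (ha : a₁ < a₂) (hb : 0 < b)
    (hE : E ∈ competitorEnergies (graphArc g a₁ a₂) (graphStrip g a₁ a₂ b)) :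
    (1 + (s : ℝ) ^ 2) ^ (-(3 / 2 : ℝ)) * (Real.pi / (2 * (a₂ - a₁))) ≤ E := by
  obtain ⟨v, G, w, hv, ⟨hw, φ, hφ, -, hφG, hφw⟩, hw1, hw0, rfl⟩ := hE
  have hs : (0 : ℝ) < 1 + (s : ℝ) ^ 2 := by positivity
  have hsub := graphArc_subset_frontier hg.continuous ha hb
  have hΓm : MeasurableSet (graphArc g a₁ a₂) := by
    have hc := hg.continuous
    exact ((measurableSet_Ioo (a := a₁) (b := a₂)).preimage
      (by fun_prop : Measurable fun p : Plane => p 0)).inter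
      (isClosed_eq (by fun_prop : Continuous fun p : Plane => p 1) (by fun_prop :
        Continuous fun p : Plane => g (p 0))).measurableSet
  set A := graphStrip g a₁ a₂ b
  set Γ := graphArc g a₁ a₂
  have mono_tendsto : ∀ {ν : Measure Plane}, ν ≤ boundaryMeasure A →
      (∀ᶠ n in atTop, MemLp (φ n) 2 ν) ∧
      Tendsto (fun n => ∫ p, φ n p ^ 2 ∂ν) atTop (𝓝 (∫ p, w p ^ 2 ∂ν)) := by
    intro ν hν
    simpa using tendsto_integral_norm_sq (fun n => (hφ n).continuous.aestronglyMeasurable)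
      (hw.mono_measure hν) (tendsto_of_tendsto_of_tendsto_of_le_of_le tendsto_const_nhds hφw
        (fun _ => zero_le) (fun n => eLpNorm_mono_measure _ hν))
  have hΓ := (mono_tendsto (Measure.restrict_mono hsub le_rfl)).2
  obtain ⟨hBmem, hB⟩ := mono_tendsto (Measure.restrict_mono (Set.sdiff_subset (t := Γ)) le_rfl)
  have hgr := (tendsto_integral_norm_sq
    (fun n => (continuous_gradient ((hφ n).of_le (by simp))).aestronglyMeasurable)
    hv.memLp_grad hφG).2
  rw [hw1] at hΓ
  have hw0' : ∫ p in frontier A \ Γ, w p ^ 2 ∂(Measure.hausdorffMeasure 1) = 0 := by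
    rw [integral_eq_zero_of_ae]
    filter_upwards [hw0] with p hp
    simp [hp]
  rw [hw0'] at hB
  -- The tangent factor blows up as `k` approaches `π / (a₂ - a₁)`; taking the limit in `n` first,
  -- with `k` fixed, multiplies it by zero.
  have key : ∀ k, 0 < k → k * (a₂ - a₁) < Real.pi →
      k ≤ √(1 + (s : ℝ) ^ 2) * (2 * (1 + (s : ℝ) ^ 2) * ∫ p in A, ‖G p‖ ^ 2) := by
    intro k hk hka
    have h := le_of_tendsto_of_tendsto (hΓ.const_mul k) (((hgr.const_mul
      (2 * (1 + (s : ℝ) ^ 2))).add (hB.const_mul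
      (k + 2 * (k * Real.tan (k * ((a₂ - a₁) / 2)))))).const_mul (√(1 + (s : ℝ) ^ 2))) (by
        filter_upwards [hBmem] with n hn
        exact mul_integral_graphArc_sq_le ((hφ n).of_le (by simp)) hg ha hb hk hka hn)
    simpa using h
  have hd : 0 < a₂ - a₁ := sub_pos.2 ha
  have key2 : Real.pi / (a₂ - a₁) ≤
      √(1 + (s : ℝ) ^ 2) * (2 * (1 + (s : ℝ) ^ 2) * ∫ p in A, ‖G p‖ ^ 2) := by
    refine le_of_forall_lt_imp_le_of_dense fun k hk => ?_
    rcases le_or_gt k 0 with h0 | h0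
    · refine h0.trans ?_
      have : 0 ≤ ∫ p in A, ‖G p‖ ^ 2 := integral_nonneg fun p => sq_nonneg _
      positivity
    · exact key k h0 ((lt_div_iff₀ hd).1 hk)
  have hpow : √(1 + (s : ℝ) ^ 2) * (1 + (s : ℝ) ^ 2) = (1 + (s : ℝ) ^ 2) ^ (3 / 2 : ℝ) := by
    rw [Real.sqrt_eq_rpow]
    nth_rw 2 [← Real.rpow_one (1 + (s : ℝ) ^ 2)]
    rw [← Real.rpow_add hs]
    norm_num
  rw [Real.rpow_neg hs.le, inv_mul_le_iff₀ (by positivity), ← hpow]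
  have e : Real.pi / (2 * (a₂ - a₁)) = Real.pi / (a₂ - a₁) / 2 := by
    field_simp
  rw [e]
  linarith

/-! ### Existence of competitors -/

theorem isWeakGradient_gradient {A : Set Plane} {v : Plane → ℝ} (hv : ContDiff ℝ ∞ v) :
    IsWeakGradient A v (gradient v) := by
  intro φ hφ hφc hφA e
  have hz : ∀ p, p ∉ A → φ p = 0 := fun p hp => image_eq_zero_of_notMem_tsupport fun h => hp (hφA h)
  have hz' : ∀ p, p ∉ A → fderiv ℝ φ p = 0 := fun p hp =>
    image_eq_zero_of_notMem_tsupport fun h => hp (hφA (tsupport_fderiv_subset ℝ h))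
  have hcφ : Continuous fun p => fderiv ℝ φ p e :=
    (hφ.continuous_fderiv (by simp)).clm_apply continuous_const
  have hcv : Continuous fun p => fderiv ℝ v p e :=
    (hv.continuous_fderiv (by simp)).clm_apply continuous_const
  rw [setIntegral_eq_integral_of_forall_compl_eq_zero fun p hp => by simp [hz' p hp],
    setIntegral_eq_integral_of_forall_compl_eq_zero fun p hp => by simp [hz p hp]]
  simp_rw [inner_gradient_left]
  exact integral_mul_fderiv_eq_neg_fderiv_mul_of_integrable
    ((hcv.mul hφ.continuous).integrable_of_hasCompactSupport hφc.mul_left)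
    ((hv.continuous.mul hcφ).integrable_of_hasCompactSupport
      ((hφc.fderiv_apply ℝ e).mul_left))
    ((hv.continuous.mul hφ.continuous).integrable_of_hasCompactSupport hφc.mul_left)
    (fun p _ => hv.differentiable (by simp) p) (fun p _ => hφ.differentiable (by simp) p)

theorem isH1_of_contDiff {A : Set Plane} {v : Plane → ℝ} (hv : ContDiff ℝ ∞ v)
    (hc : HasCompactSupport v) : IsH1 A v (gradient v) where
  memLp := (hv.continuous.memLp_of_hasCompactSupport hc).restrict A
  memLp_grad := by
    refine (Continuous.memLp_of_hasCompactSupport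
      (continuous_gradient (hv.of_le (by simp))) ?_).restrict A
    exact (hc.fderiv ℝ).comp_left (map_zero (InnerProductSpace.toDual ℝ Plane).symm)
  weakGradient := isWeakGradient_gradient hv

theorem hasTrace_of_contDiff {A : Set Plane} {v : Plane → ℝ} (hv : ContDiff ℝ ∞ v)
    (h : MemLp v 2 (boundaryMeasure A)) : HasTrace A v (gradient v) v where
  memLp := h
  approx := ⟨fun _ => v, fun _ => hv, by simp, by simp, by simp⟩

/-- Needed because the real infimum of an empty set is 0, which would contradict the positive lower
bound. A normalized bump centred on the arc is a competitor. -/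
theorem competitorEnergies_nonempty {g : ℝ → ℝ} {s : ℝ≥0} (hg : LipschitzWith s g)
    {a₁ a₂ b : ℝ} (ha : a₁ < a₂) (hb : 0 < b) :
    (competitorEnergies (graphArc g a₁ a₂) (graphStrip g a₁ a₂ b)).Nonempty := by
  have hgc := hg.continuous
  have hm : (a₁ + a₂) / 2 ∈ Set.Ioo a₁ a₂ := ⟨by linarith, by linarith⟩
  -- Unbounded below the graph, `U` is an open neighbourhood of the arc that meets the boundary of
  -- the strip only in the arc.
  set U : Set Plane := {p | p 0 ∈ Set.Ioo a₁ a₂ ∧ p 1 - g (p 0) ∈ Set.Iio b}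
  have hU : IsOpen U :=
    (isOpen_Ioo.preimage (by fun_prop : Continuous fun p : Plane => p 0)).inter
      (isOpen_Iio.preimage (by fun_prop : Continuous fun p : Plane => p 1 - g (p 0)))
  obtain ⟨ψ, hψU, hψc, hψ, hψr, hψ1⟩ := exists_contDiff_tsupport_subset (n := ⊤)
    (hU.mem_nhds (x := shear g ((a₁ + a₂) / 2) 0) ⟨hm, by simpa using hb⟩)
  have hUΓ : ∀ p ∈ frontier (graphStrip g a₁ a₂ b), p ∈ U → p ∈ graphArc g a₁ a₂ := by
    intro p hp hpU
    rw [(isOpen_graphStrip hgc a₁ a₂ b).frontier_eq, graphStrip_eq] at hp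
    have h1 := (closure_graphStrip_subset hgc a₁ a₂ b (graphStrip_eq g a₁ a₂ b ▸ hp.1)).2.1
    refine ⟨hpU.1, ?_⟩
    by_contra hne
    exact hp.2 ⟨hpU.1, lt_of_le_of_ne h1 fun h => hne (by linarith), hpU.2⟩
  have hzero : ∀ p ∈ frontier (graphStrip g a₁ a₂ b) \ graphArc g a₁ a₂, ψ p = 0 := fun p hp =>
    image_eq_zero_of_notMem_tsupport fun h => hp.2 (hUΓ p hp.1 (hψU h))
  have hfin : IsFiniteMeasure
      ((Measure.hausdorffMeasure 1 : Measure Plane).restrict (graphArc g a₁ a₂)) := by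
    refine ⟨?_⟩
    rw [Measure.restrict_apply_univ, graphArc_eq_image]
    refine ((lipschitzWith_shear_left hg 0).hausdorffMeasure_image_le
      (d := 1) zero_le_one _).trans_lt ?_
    rw [hausdorffMeasure_real]
    simpa using ENNReal.mul_lt_top ENNReal.coe_lt_top ENNReal.ofReal_lt_top
  have hψΓ : MemLp ψ 2 ((Measure.hausdorffMeasure 1).restrict (graphArc g a₁ a₂)) := by
    refine MemLp.of_bound hψ.continuous.aestronglyMeasurable 1 (ae_of_all _ fun p => ?_)
    have h := hψr ⟨p, rfl⟩
    rw [Real.norm_eq_abs, abs_le]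
    exact ⟨by linarith [h.1], h.2⟩
  have hψb : MemLp ψ 2 (boundaryMeasure (graphStrip g a₁ a₂ b)) := by
    have hind : U.indicator ψ = ψ :=
      Set.indicator_eq_self.2 ((subset_tsupport ψ).trans hψU)
    rw [← hind, memLp_indicator_iff_restrict hU.measurableSet, boundaryMeasure,
      Measure.restrict_restrict hU.measurableSet]
    exact hψΓ.mono_measure (Measure.restrict_mono (fun p hp => hUΓ p hp.2 hp.1) le_rfl)
  set c := ∫ p in graphArc g a₁ a₂, ψ p ^ 2 ∂(Measure.hausdorffMeasure 1)
  have hc : 0 < c := by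
    -- Projection to the first axis bounds `c` below by the integral of a continuous function that
    -- equals 1 at the midpoint.
    have hcont := (lipschitzWith_shear_left hg 0).continuous
    have hle := setIntegral_sq_comp_le hcont (lipschitzWith_proj 0) (fun x => shear_zero g x 0)
      (I := Set.Ioo a₁ a₂) (fun x hx => shear_mem_graphArc.2 ⟨hx, rfl⟩) hψ.continuous hψΓ
    refine lt_of_lt_of_le ?_ hle
    rw [← integral_Ioc_eq_integral_Ioo, ← intervalIntegral.integral_of_le ha.le]
    refine intervalIntegral.integral_pos ha ((hψ.continuous.comp hcont).pow 2).continuousOn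
      (fun _ _ => sq_nonneg _) ⟨_, Set.Ioo_subset_Icc_self hm, ?_⟩
    rw [hψ1]
    norm_num
  have hv : ContDiff ℝ ∞ fun p => (√c)⁻¹ * ψ p := contDiff_const.mul hψ
  refine ⟨_, _, _, _, isH1_of_contDiff hv hψc.mul_left,
    hasTrace_of_contDiff hv (hψb.const_mul _), ?_, ?_, rfl⟩
  · simp_rw [mul_pow]
    rw [integral_const_mul, inv_pow, Real.sq_sqrt hc.le]
    exact inv_mul_cancel₀ hc.ne'
  · have hmeas : MeasurableSet {p | (√c)⁻¹ * ψ p = 0} :=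
      (isClosed_eq hv.continuous continuous_const).measurableSet
    refine (ae_restrict_iff hmeas).2 (ae_of_all _ fun p hp => ?_)
    simp [hzero p hp]

theorem le_capacityK {g : ℝ → ℝ} {s : ℝ≥0} (hg : LipschitzWith s g) {a₁ a₂ b : ℝ}
    (ha : a₁ < a₂) (hb : 0 < b) :
    (1 + (s : ℝ) ^ 2) ^ (-(3 / 2 : ℝ)) * (Real.pi / (2 * (a₂ - a₁))) ≤
      capacityK (graphArc g a₁ a₂) (graphStrip g a₁ a₂ b) :=
  le_csInf (competitorEnergies_nonempty hg ha hb) fun _ hE => le_competitorEnergies hg ha hb hE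

/-! ### The optimal Lipschitz constant and the conclusion -/

/-- A function that is Lipschitz on `[0, a₀]` has the essential supremum of its derivative as a
Lipschitz constant. -/
theorem LipschitzOnWith.lipschitzOnWith_derivSupNorm {a₀ : ℝ} {g : ℝ → ℝ} {C : ℝ≥0}
    (hg : LipschitzOnWith C g (Set.Icc 0 a₀)) :
    LipschitzOnWith (derivSupNorm g a₀).toNNReal g (Set.Icc 0 a₀) := by
  have hnn : 0 ≤ derivSupNorm g a₀ := ENNReal.toReal_nonneg
  -- Without finiteness, `toReal` would turn an infinite supremum into 0.
  have hfin : eLpNorm (deriv g) ⊤ (volume.restrict (Set.Ioo 0 a₀)) ≠ ⊤ := by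
    refine (lt_of_le_of_lt (eLpNormEssSup_le_of_ae_bound (C := C) ?_) ENNReal.ofReal_lt_top).ne
    filter_upwards [ae_restrict_mem measurableSet_Ioo] with x hx
    exact norm_deriv_le_of_lipschitzOn (Icc_mem_nhds hx.1 hx.2) hg
  have hae : ∀ᵐ x, x ∈ Set.Ioo 0 a₀ → ‖deriv g x‖ ≤ derivSupNorm g a₀ := by
    rw [← ae_restrict_iff' measurableSet_Ioo]
    filter_upwards [ae_le_eLpNormEssSup (f := deriv g) (μ := volume.restrict (Set.Ioo 0 a₀))]
      with x hx
    rw [← toReal_enorm]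
    exact ENNReal.toReal_mono hfin hx
  have hle : ∀ x ∈ Set.Icc 0 a₀, ∀ y ∈ Set.Icc 0 a₀, x ≤ y →
      dist (g x) (g y) ≤ derivSupNorm g a₀ * dist x y := by
    intro x hx y hy hxy
    have hsub : Set.uIcc x y ⊆ Set.Icc 0 a₀ := Set.uIcc_subset_Icc hx hy
    rw [dist_comm (g x), Real.dist_eq,
      ← ((hg.mono hsub).absolutelyContinuousOnInterval).integral_deriv_eq_sub, dist_comm x,
      Real.dist_eq, ← Real.norm_eq_abs]
    refine intervalIntegral.norm_integral_le_of_norm_le_const_ae ?_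
    -- The integral runs over `(x, y]`, which may contain `a₀`; this single point is null.
    filter_upwards [hae, Measure.ae_ne volume a₀] with t ht hta htI
    rw [Set.uIoc_of_le hxy] at htI
    exact ht ⟨hx.1.trans_lt htI.1, lt_of_le_of_ne (htI.2.trans hy.2) hta⟩
  refine LipschitzOnWith.of_dist_le_mul fun x hx y hy => ?_
  rw [Real.coe_toNNReal _ hnn]
  rcases le_total x y with h | h
  · exact hle x hx y hy h
  · rw [dist_comm (g x), dist_comm x]
    exact hle y hy x hx h

theorem mainTheorem6 (a₀ : ℝ) (g : ℝ → ℝ)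
    (hg : ∃ C : ℝ≥0, LipschitzOnWith C g (Set.Icc 0 a₀)) :
    (∀ M : ℝ, ∃ δ : ℝ, 0 < δ ∧ ∀ a₁ a₂ : ℝ, 0 ≤ a₁ → a₁ < a₂ → a₂ ≤ a₀ → a₂ - a₁ < δ →
      ∀ b : ℝ, 0 < b → M < capacityK (graphArc g a₁ a₂) (graphStrip g a₁ a₂ b)) ∧
    (∀ a₁ a₂ b : ℝ, 0 ≤ a₁ → a₁ < a₂ → a₂ ≤ a₀ → 0 < b →
      (1 + derivSupNorm g a₀ ^ 2) ^ (-(3 / 2 : ℝ)) * (Real.pi / (2 * (a₂ - a₁))) ≤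
        capacityK (graphArc g a₁ a₂) (graphStrip g a₁ a₂ b)) := by
  obtain ⟨C, hC⟩ := hg
  -- The estimates use a globally Lipschitz function; the extension keeps the constant, and arc and
  -- strip see only values on `(a₁, a₂)`.
  obtain ⟨h, hh, hgh⟩ := hC.lipschitzOnWith_derivSupNorm.extend_real
  have hnn : 0 ≤ derivSupNorm g a₀ := ENNReal.toReal_nonneg
  have bound : ∀ a₁ a₂ b : ℝ, 0 ≤ a₁ → a₁ < a₂ → a₂ ≤ a₀ → 0 < b →
      (1 + derivSupNorm g a₀ ^ 2) ^ (-(3 / 2 : ℝ)) * (Real.pi / (2 * (a₂ - a₁))) ≤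
        capacityK (graphArc g a₁ a₂) (graphStrip g a₁ a₂ b) := by
    intro a₁ a₂ b h0 ha ha₀ hb
    have hmem : ∀ x ∈ Set.Ioo a₁ a₂, g x = h x := fun x hx =>
      hgh ⟨h0.trans hx.1.le, hx.2.le.trans ha₀⟩
    have e1 : graphArc g a₁ a₂ = graphArc h a₁ a₂ := by
      ext p
      exact and_congr_right fun hp => by rw [hmem _ hp]
    have e2 : graphStrip g a₁ a₂ b = graphStrip h a₁ a₂ b := by
      ext p
      exact and_congr_right fun hp => by rw [hmem _ hp]
    have := le_capacityK hh ha hb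
    rwa [Real.coe_toNNReal _ hnn, ← e1, ← e2] at this
  refine ⟨fun M => ?_, bound⟩
  set c := (1 + derivSupNorm g a₀ ^ 2) ^ (-(3 / 2 : ℝ)) with hc
  have hc0 : 0 < c := by positivity
  have hM : 0 < |M| + 1 := by positivity
  -- This `δ` is the width at which the explicit bound equals `|M| + 1`.
  refine ⟨c * Real.pi / (2 * (|M| + 1)), by positivity, fun a₁ a₂ h0 ha ha₀ hδ b hb => ?_⟩
  refine lt_of_lt_of_le ?_ (bound a₁ a₂ b h0 ha ha₀ hb)
  have hd : 0 < a₂ - a₁ := sub_pos.2 ha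
  rw [lt_div_iff₀ (by positivity)] at hδ
  rw [← mul_div_assoc, lt_div_iff₀ (by positivity)]
  nlinarith [mul_le_mul_of_nonneg_right (le_abs_self M) hd.le]
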